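/- Let $\mathcal X$ be a measurable space, let $B\ge 1$ and $n\ge 2B$ be integers, let $g:\mathcal X\to[0,1]$ be measurable, and let $P$ be a probability distribution on $\mathcal X\times[0,1]$ such that, for $(X,Y)\sim P$, the law of $g(X)$ is absolutely continuous with respect to Lebesgue measure. Let $\mathcal D_n=\{(X_i,Y_i)\}_{i=1}^n$ be drawn i.i.d. from $P$. Consider the original (Zadrozny–Elkan) histogram binning, that is, uniform-mass binning without sample splitting, which produces $h:\mathcal X\to[0,1]$ as follows. Let $S_{(1)}\le\dots\le S_{(n)}$ be the order statistics of the scores $g(X_1),\dots,g(X_n)$, let $Y_{(k)}$ be the label belonging to $S_{(k)}$, and put $S_{(0)}=0$, $S_{(n+1)}=1$, $A_b=\lceil b(n+1)/B\rceil$ for $0\le b\le B$. For $1\le b\le B$, with $l=A_{b-1}$ and $u=A_b$, let \[ \widehat\Pi_b=\begin{cases}\operatorname{Mean}(Y_{(l+1)},\dots,Y_{(u-1)},Y_{(u)}), & b<B,\\ \operatorname{Mean}(Y_{(l+1)},\dots,Y_{(u-1)}), & b=B,\end{cases} \qquad h(x)=\sum_{b=1}^B \mathbf 1\{S_{(A_{b-1})}\le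 g(x)<S_{(A_b)}\}\,\widehat\Pi_b . \] Let $\alpha\in(0,1)$ and \[ \varepsilon=\sqrt{\frac{\log(2B/\alpha)}{2(\lfloor n/B\rfloor-1)}}+\frac1{\lfloor n/B\rfloor}. \] Then this procedure is $(\varepsilon,\alpha)$-conditionally calibrated: with probability at least $1-\alpha$ over $\mathcal D_n$, \[ \bigl|\mathbb E[Y\mid h(X)=r]-r\bigr|\le\varepsilon\quad\text{for every } r\in\operatorname{Range}(h), \] where $(X,Y)\sim P$ is independent of $\mathcal D_n$, the expectation is over $(X,Y)$ with $h$ held fixed, and $r\mapsto\mathbb E[Y\mid h(X)=r]$ denotes a suitable version of the conditional expectation (its value is determined at every $r$ with $P(h(X)=r)>0$, and is irrelevant at other $r$). Moreover, with probability at least $1-\alpha$ over $\mathcal D_n$, simultaneously for all $p\in[1,\infty)$, \[ \ell_p\text{-ECE}(h):=\Bigl(\mathbb E_X\bigl|\mathbb E[Y\mid h(X)]-h(X)\bigr|^p\Bigr)^{1/p}\le\varepsilon . \] -/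

import Mathlib

open MeasureTheory ProbabilityTheory

noncomputable section

namespace HistogramBinning

/-- The class `𝒢` of all measurable functions `𝒳 → [0, 1]`. -/
abbrev Predictor (𝒳 : Type*) [MeasurableSpace 𝒳] : Type _ :=
  {g : 𝒳 → unitInterval // Measurable g}

/-- A calibration data set `(X₁, Y₁), …, (Xₙ, Yₙ)` with labels in `[0, 1]`. -/
abbrev Dataset (𝒳 : Type*) (n : ℕ) : Type _ := Fin n → 𝒳 × unitInterval

/-- A calibrator `H : 𝒢 × (𝒳 × [0, 1])ⁿ → 𝒢`. -/
abbrev Calibrator (𝒳 : Type*) [MeasurableSpace 𝒳] (n : ℕ) : Type _ :=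
  Predictor 𝒳 → Dataset 𝒳 n → Predictor 𝒳

section Calibration

variable {𝒳 : Type*} [MeasurableSpace 𝒳]

/-- The random variable `E[Y | h(X)]` for `(X, Y) ∼ P`, where `(X, Y)` is the coordinate pair. -/
def condMean (P : Measure (𝒳 × unitInterval)) (h : Predictor 𝒳) : 𝒳 × unitInterval → ℝ :=
  P[fun z => (z.2 : ℝ) | MeasurableSpace.comap (fun z : 𝒳 × unitInterval => h.1 z.1) inferInstance]

/-- `φ` is (a version of) the function `r ↦ E[Y | h(X) = r]`. At every `r` with
`P(h(X) = r) > 0` the value `φ r` is forced to be the elementary conditional expectation. -/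
def IsCondMeanFun (P : Measure (𝒳 × unitInterval)) (h : Predictor 𝒳)
    (φ : unitInterval → ℝ) : Prop :=
  Measurable φ ∧ (fun z : 𝒳 × unitInterval => φ (h.1 z.1)) =ᵐ[P] condMean P h

/-- `|E[Y | h(X) = r] - r| ≤ ε` for all `r ∈ Range h`. -/
def ApproxCalibrated (P : Measure (𝒳 × unitInterval)) (h : Predictor 𝒳) (ε : ℝ) : Prop :=
  ∃ φ : unitInterval → ℝ, IsCondMeanFun P h φ ∧ ∀ r ∈ Set.range h.1, |φ r - (r : ℝ)| ≤ ε

/-- The `ℓ_p` expected calibration error `(E_X |E[Y | h(X)] - h(X)|^p)^{1/p}`. -/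
def ece (P : Measure (𝒳 × unitInterval)) (h : Predictor 𝒳) (p : ℝ) : ℝ :=
  (∫ z, |condMean P h z - (h.1 z.1 : ℝ)| ^ p ∂P) ^ (1 / p)

/-- The property `A` of `n` independent draws from `P` holds with probability at least `1 - α`.
It is phrased through the failure event: for non-measurable `A` the (outer) bound on the failure
event is the stronger requirement. -/
def HoldsWithProb (P : Measure (𝒳 × unitInterval)) (n : ℕ) (α : ℝ)
    (A : Dataset 𝒳 n → Prop) : Prop :=
  Measure.pi (fun _ : Fin n => P) {D | ¬ A D} ≤ ENNReal.ofReal α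

/-- The requirement of `(ε, α)`-conditional calibration of `H` at the predictor `g` and the
distribution `P`. -/
def ConditionallyCalibratedAt {n : ℕ} (H : Calibrator 𝒳 n) (ε α : ℝ) (g : Predictor 𝒳)
    (P : Measure (𝒳 × unitInterval)) : Prop :=
  HoldsWithProb P n α fun D => ApproxCalibrated P (H g D) ε

end Calibration

section Algorithm

variable {n : ℕ}

/-- `S_(k)` for `0 ≤ k ≤ n + 1`, with `S_(0) = 0` and `S_(n+1) = 1`. -/
def orderStat (s : Fin n → unitInterval) (k : ℕ) : unitInterval :=
  if k = 0 then 0 else if hk : k - 1 < n then s (Tuple.sort s ⟨k - 1, hk⟩) else 1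

/-- `Y_(k)` for `1 ≤ k ≤ n`: the label that belongs to the `k`-th smallest score. -/
def orderedLabel (s y : Fin n → unitInterval) (k : ℕ) : unitInterval :=
  if hk : k - 1 < n then y (Tuple.sort s ⟨k - 1, hk⟩) else 0

/-- The boundary index `A_b = ⌈b (n + 1) / B⌉`. -/
def boundary (n B b : ℕ) : ℕ := ⌈(b : ℚ) * (((n : ℚ) + 1) / (B : ℚ))⌉₊

/-- The ranks of the points used to estimate the bias of bin `b ∈ {1, …, B}`, where
`l = A_{b-1}`, `u = A_b`: these are `l + 1, …, u` for `b < B` and `l + 1, …, u - 1` for `b = B`. -/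
def binRanks (n B b : ℕ) : Finset ℕ :=
  Finset.Ioc (boundary n B (b - 1)) (if b < B then boundary n B b else boundary n B b - 1)

/-- The bias estimate of bin `b`: the mean of the labels with ranks in `binRanks n B b`. -/
def biasEstimate (B : ℕ) (s y : Fin n → unitInterval) (b : ℕ) : ℝ :=
  (∑ k ∈ binRanks n B b, (orderedLabel s y k : ℝ)) / ((binRanks n B b).card : ℝ)

/-- The recalibrated score as a function of the original score `t`:
`∑_b 1{S_(A_{b-1}) ≤ t < S_(A_b)} Π̂_b`. -/
def binnedScore (B : ℕ) (s y : Fin n → unitInterval) (t : unitInterval) : ℝ :=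
  ∑ b ∈ Finset.Icc 1 B,
    if orderStat s (boundary n B (b - 1)) ≤ t ∧ t < orderStat s (boundary n B b)
      then biasEstimate B s y b else 0

theorem orderStat_mono (s : Fin n → unitInterval) : Monotone (orderStat s) := by
  intro i j hij
  unfold orderStat
  by_cases hi : i = 0
  · rw [if_pos hi]
    exact unitInterval.nonneg'
  have hj : j ≠ 0 := by omega
  rw [if_neg hi, if_neg hj]
  by_cases hjn : j - 1 < n
  · have hin : i - 1 < n := by omega
    rw [dif_pos hin, dif_pos hjn]
    exact Tuple.monotone_sort s (Fin.mk_le_mk.mpr (by omega))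
  · rw [dif_neg hjn]
    exact unitInterval.le_one'

theorem boundary_mono (n B : ℕ) : Monotone (boundary n B) := by
  intro i j hij
  unfold boundary
  gcongr

theorem biasEstimate_mem (B : ℕ) (s y : Fin n → unitInterval) (b : ℕ) :
    biasEstimate B s y b ∈ Set.Icc (0 : ℝ) 1 := by
  unfold biasEstimate
  constructor
  · exact div_nonneg (Finset.sum_nonneg fun k _ => (orderedLabel s y k).2.1) (Nat.cast_nonneg _)
  · refine div_le_one_of_le₀ ?_ (Nat.cast_nonneg _)
    calc ∑ k ∈ binRanks n B b, (orderedLabel s y k : ℝ)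
        ≤ ∑ _k ∈ binRanks n B b, (1 : ℝ) :=
          Finset.sum_le_sum fun k _ => (orderedLabel s y k).2.2
      _ = _ := by simp

theorem binnedScore_mem (B : ℕ) (s y : Fin n → unitInterval) (t : unitInterval) :
    binnedScore B s y t ∈ Set.Icc (0 : ℝ) 1 := by
  unfold binnedScore
  by_cases h : ∃ b ∈ Finset.Icc 1 B,
      orderStat s (boundary n B (b - 1)) ≤ t ∧ t < orderStat s (boundary n B b)
  · obtain ⟨b, hb, h1, h2⟩ := h
    rw [Finset.sum_eq_single_of_mem b hb, if_pos ⟨h1, h2⟩]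
    · exact biasEstimate_mem B s y b
    · intro c hc hcb
      apply if_neg
      rintro ⟨h3, h4⟩
      have hm := (orderStat_mono s).comp (boundary_mono n B)
      have hc1 := (Finset.mem_Icc.mp hc).1
      have hb1 := (Finset.mem_Icc.mp hb).1
      rcases lt_or_gt_of_ne hcb with hlt | hlt
      · have := hm (show c ≤ b - 1 by omega)
        exact absurd (h4.trans_le (this.trans h1)) (lt_irrefl _)
      · have := hm (show b ≤ c - 1 by omega)
        exact absurd (h2.trans_le (this.trans h3)) (lt_irrefl _)
  · push Not at h
    rw [Finset.sum_eq_zero]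
    · simp
    · intro b hb
      apply if_neg
      rintro ⟨h1, h2⟩
      exact absurd h2 (not_lt.mpr (h b hb h1))

theorem measurable_binnedScore (B : ℕ) (s y : Fin n → unitInterval) :
    Measurable (binnedScore B s y) := by
  unfold binnedScore
  refine Finset.measurable_sum _ fun b _ => ?_
  exact Measurable.ite (measurableSet_Ici.inter measurableSet_Iio)
    measurable_const measurable_const

/-- Histogram binning with `B` bins in its original form (uniform-mass binning without sample
splitting, the right boundary point of each bin but the last included in the bin mean). -/
def originalUMD {𝒳 : Type*} [MeasurableSpace 𝒳] (n B : ℕ) : Calibrator 𝒳 n := fun g D =>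
  ⟨fun x => ⟨binnedScore B (fun i => g.1 (D i).1) (fun i => (D i).2) (g.1 x),
      binnedScore_mem B _ _ _⟩,
    ((measurable_binnedScore B _ _).comp g.2).subtype_mk⟩

end Algorithm

end HistogramBinning

end

/-! Fix a bin with boundary ranks `l < u`, and let `T` be the set of indices whose scores lie
strictly between `S_(l)` and `S_(u)`. Freeze the data outside `T`. The endpoints are then
determined: among the frozen scores, `S_(l)` is the `l`-th smallest and `S_(u)` the `(l+1)`-th
smallest, with the conventions 0 and 1 at the extremes (`orderStat_eq_of_interior_eq`). Conversely,
the points of `T` may move freely between these endpoints without changing the event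
(`interior_eq_of_forall_mem`). So each nonempty section of the event is a product box, and on it the
inner points are i.i.d. from `P` conditioned on the bin. Hoeffding applies in the section although
the bin was chosen from the same data, and integrating over the frozen points and summing over the
disjoint choices of `T` gives `measure_deviation_le`.

The extra label at the right endpoint moves the mean by at most `1/⌊n/B⌋`
(`abs_biasEstimate_sub_le`), and a union bound over the `B` bins finishes the probability estimate.
All deviations are multiplied by the mass of the bin, so null bins need no special treatment and the
bounds add up when several bins share an estimate (`approxCalibrated_of_bins`).

Absolute continuity enters only through the absence of atoms: almost surely there are no ties, no
score is 0 or 1, and bin endpoints carry no mass. -/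

namespace HistogramBinning

/-! ### Order statistics by counting, and the points strictly inside a bin -/

section OrderStatistics

/-- `a` is a `k`-th smallest value (counting from `1`) of the family `s` on the index set `S`. -/
def IsRank {ι β : Type*} [LinearOrder β] (S : Finset ι) (s : ι → β) (k : ℕ) (a : β) : Prop :=
  (S.filter fun m => s m < a).card < k ∧ k ≤ (S.filter fun m => s m ≤ a).card

/-- If `b < a`, the at least `k` values up to `b` would all be below `a`, where there are fewer than
`k`. The counting form of rank makes sense on any index subset, so ranks can be followed when points
are discarded. -/
theorem IsRank.le {ι β : Type*} [LinearOrder β] {S : Finset ι} {s : ι → β} {k : ℕ} {a b : β}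
    (ha : IsRank S s k a) (hb : IsRank S s k b) : a ≤ b := by
  by_contra! hlt
  have : (S.filter fun m => s m ≤ b).card ≤ (S.filter fun m => s m < a).card :=
    Finset.card_le_card fun m hm => by
      simp only [Finset.mem_filter] at hm ⊢
      exact ⟨hm.1, hm.2.trans_lt hlt⟩
  have := ha.1
  have := hb.2
  omega

theorem IsRank.unique {ι β : Type*} [LinearOrder β] {S : Finset ι} {s : ι → β} {k : ℕ} {a b : β}
    (ha : IsRank S s k a) (hb : IsRank S s k b) : a = b :=
  le_antisymm (ha.le hb) (hb.le ha)

theorem IsRank.congr {ι β : Type*} [LinearOrder β] {S : Finset ι} {s s' : ι → β} {k : ℕ} {a : β}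
    (ha : IsRank S s k a) (h : ∀ m ∈ S, s' m = s m) : IsRank S s' k a := by
  unfold IsRank at *
  rw [Finset.filter_congr (q := fun m => s m < a) fun m hm => by rw [h m hm],
    Finset.filter_congr (p := fun m => s' m ≤ a) (q := fun m => s m ≤ a)
      fun m hm => by rw [h m hm]]
  exact ha

theorem card_filter_univ_eq {ι : Type*} [Fintype ι] [DecidableEq ι] (T : Finset ι)
    (p : ι → Prop) [DecidablePred p] :
    (Finset.univ.filter p).card = (T.filter p).card + (Tᶜ.filter p).card := by
  rw [← Finset.card_union_of_disjoint, ← Finset.filter_union, Finset.union_compl]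
  exact Finset.disjoint_filter_filter disjoint_compl_right

/-- Discarding values above `a` does not change which rank `a` has. -/
theorem isRank_univ_iff_of_lt {ι β : Type*} [LinearOrder β] [Fintype ι] [DecidableEq ι]
    {T : Finset ι} {s : ι → β} {k : ℕ} {a : β} (h : ∀ m ∈ T, a < s m) :
    IsRank Finset.univ s k a ↔ IsRank Tᶜ s k a := by
  unfold IsRank
  rw [card_filter_univ_eq T, card_filter_univ_eq T fun m => s m ≤ a,
    Finset.filter_false_of_mem (s := T) fun m hm => (h m hm).not_gt,
    Finset.filter_false_of_mem (s := T) (p := fun m => s m ≤ a) fun m hm => (h m hm).not_ge]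
  simp

/-- Discarding values below `b` lowers the rank of `b` by their number. -/
theorem isRank_univ_add_card_iff_of_lt {ι β : Type*} [LinearOrder β] [Fintype ι] [DecidableEq ι]
    {T : Finset ι} {s : ι → β} {k : ℕ} {b : β} (h : ∀ m ∈ T, s m < b) :
    IsRank Finset.univ s (k + T.card) b ↔ IsRank Tᶜ s k b := by
  unfold IsRank
  rw [card_filter_univ_eq T, card_filter_univ_eq T fun m => s m ≤ b,
    Finset.filter_true_of_mem (s := T) fun m hm => h m hm,
    Finset.filter_true_of_mem (s := T) (p := fun m => s m ≤ b) fun m hm => (h m hm).le]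
  constructor <;> rintro ⟨h1, h2⟩ <;> constructor <;> omega

variable {n : ℕ}

theorem orderStat_zero (s : Fin n → unitInterval) : orderStat s 0 = 0 := by
  simp [orderStat]

theorem orderStat_last (s : Fin n → unitInterval) : orderStat s (n + 1) = 1 := by
  simp [orderStat]

theorem orderStat_val_succ (s : Fin n → unitInterval) (p : Fin n) :
    orderStat s (p + 1) = s (Tuple.sort s p) := by
  simp [orderStat]

theorem orderedLabel_val_succ (s y : Fin n → unitInterval) (p : Fin n) :
    orderedLabel s y (p + 1) = y (Tuple.sort s p) := by
  simp [orderedLabel]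

theorem isRank_orderStat (s : Fin n → unitInterval) {k : ℕ} (hk : 1 ≤ k) (hkn : k ≤ n) :
    IsRank Finset.univ s k (orderStat s k) := by
  obtain ⟨p, rfl⟩ : ∃ p : Fin n, k = p + 1 := ⟨⟨k - 1, by omega⟩, by simp; omega⟩
  rw [orderStat_val_succ]
  have hmono := Tuple.monotone_sort s
  constructor
  · have : (Finset.univ.filter fun m => s m < s (Tuple.sort s p)) ⊆
        (Finset.Iio p).map (Tuple.sort s).toEmbedding := by
      intro m hm
      simp only [Finset.mem_filter, Finset.mem_univ, true_and] at hm
      refine Finset.mem_map.mpr ⟨(Tuple.sort s).symm m, ?_, by simp⟩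
      rw [Finset.mem_Iio]
      by_contra! hle
      have := hmono hle
      simp only [Function.comp_apply, Equiv.apply_symm_apply] at this
      exact absurd hm this.not_gt
    have := Finset.card_le_card this
    rw [Finset.card_map, Fin.card_Iio] at this
    omega
  · have : (Finset.Iic p).map (Tuple.sort s).toEmbedding ⊆
        (Finset.univ.filter fun m => s m ≤ s (Tuple.sort s p)) := by
      intro m hm
      obtain ⟨q, hq, rfl⟩ := Finset.mem_map.mp hm
      simp only [Finset.mem_filter, Finset.mem_univ, true_and]
      exact hmono (Finset.mem_Iic.mp hq)
    have := Finset.card_le_card this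
    rwa [Finset.card_map, Fin.card_Iic] at this

/-- The indices of the scores strictly between `S_(l)` and `S_(u)`. -/
noncomputable def interior (s : Fin n → unitInterval) (l u : ℕ) : Finset (Fin n) :=
  Finset.univ.filter fun m => orderStat s l < s m ∧ s m < orderStat s u

theorem mem_interior {s : Fin n → unitInterval} {l u : ℕ} {m : Fin n} :
    m ∈ interior s l u ↔ orderStat s l < s m ∧ s m < orderStat s u := by
  simp [interior]

/-- The position of the index `m` in the sorted order of `s`, counted from `1`. -/
noncomputable def position (s : Fin n → unitInterval) (m : Fin n) : ℕ := (Tuple.sort s).symm m + 1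

theorem position_injective (s : Fin n → unitInterval) : Function.Injective (position s) := by
  intro a b h
  simp only [position, add_left_inj] at h
  exact (Tuple.sort s).symm.injective (Fin.ext h)

theorem orderStat_position (s : Fin n → unitInterval) (m : Fin n) :
    orderStat s (position s m) = s m := by
  rw [position, orderStat_val_succ, Equiv.apply_symm_apply]

theorem orderedLabel_position (s y : Fin n → unitInterval) (m : Fin n) :
    orderedLabel s y (position s m) = y m := by
  rw [position, orderedLabel_val_succ, Equiv.apply_symm_apply]

theorem image_position_interior_subset (s : Fin n → unitInterval) (l u : ℕ) :
    (interior s l u).image (position s) ⊆ Finset.Ioo l u := by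
  intro r hr
  obtain ⟨m, hm, rfl⟩ := Finset.mem_image.mp hr
  rw [mem_interior, ← orderStat_position s m] at hm
  exact Finset.mem_Ioo.mpr ⟨(orderStat_mono s).reflect_lt hm.1, (orderStat_mono s).reflect_lt hm.2⟩

/-- Positions of interior points always lie in `Ioo l u`; with the full count, `position` is a
bijection onto it and reindexes the sum. -/
theorem sum_orderedLabel_Ioo (s y : Fin n → unitInterval) {l u : ℕ}
    (hc : (interior s l u).card = u - l - 1) :
    ∑ r ∈ Finset.Ioo l u, (orderedLabel s y r : ℝ) = ∑ m ∈ interior s l u, (y m : ℝ) := by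
  have himg : (interior s l u).image (position s) = Finset.Ioo l u := by
    refine Finset.eq_of_subset_of_card_le (image_position_interior_subset s l u) ?_
    rw [Finset.card_image_of_injective _ (position_injective s), hc, Nat.card_Ioo]
  rw [← himg, Finset.sum_image fun a _ b _ h => position_injective s h]
  simp only [orderedLabel_position]

/-- Without ties the sorted scores increase strictly; the bounds 0 and 1 extend this to the
conventional values `S_(0)` and `S_(n+1)`. -/
theorem card_interior_of_injective {s : Fin n → unitInterval} (hs : Function.Injective s)
    (h0 : ∀ m, 0 < s m) (h1 : ∀ m, s m < 1) {l u : ℕ} (hu : u ≤ n + 1) :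
    (interior s l u).card = u - l - 1 := by
  have hstrict : StrictMono (s ∘ Tuple.sort s) :=
    (Tuple.monotone_sort s).strictMono_of_injective (hs.comp (Tuple.sort s).injective)
  have himg : (interior s l u).image (position s) = Finset.Ioo l u := by
    refine (image_position_interior_subset s l u).antisymm fun r hr => ?_
    rw [Finset.mem_Ioo] at hr
    obtain ⟨p, rfl⟩ : ∃ p : Fin n, r = p + 1 := ⟨⟨r - 1, by omega⟩, by simp; omega⟩
    refine Finset.mem_image.mpr ⟨Tuple.sort s p, mem_interior.mpr ⟨?_, ?_⟩, by simp [position]⟩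
    · rcases Nat.eq_zero_or_pos l with rfl | hl
      · rw [orderStat_zero]
        exact h0 _
      · obtain ⟨q, rfl⟩ : ∃ q : Fin n, l = q + 1 := ⟨⟨l - 1, by omega⟩, by simp; omega⟩
        rw [orderStat_val_succ]
        exact hstrict (Fin.lt_def.mpr (by omega))
    · rcases hu.eq_or_lt with rfl | hun
      · rw [orderStat_last]
        exact h1 _
      · obtain ⟨q, rfl⟩ : ∃ q : Fin n, u = q + 1 := ⟨⟨u - 1, by omega⟩, by simp; omega⟩
        rw [orderStat_val_succ]
        exact hstrict (Fin.lt_def.mpr (by omega))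
  rw [← Finset.card_image_of_injective _ (position_injective s), himg, Nat.card_Ioo]

theorem isRank_compl_lower {s : Fin n → unitInterval} {l u : ℕ} {T : Finset (Fin n)}
    (hT : interior s l u = T) (hl : 1 ≤ l) (hln : l ≤ n) :
    IsRank Tᶜ s l (orderStat s l) :=
  (isRank_univ_iff_of_lt fun _ hm => (mem_interior.mp (hT ▸ hm)).1).mp (isRank_orderStat s hl hln)

/-- Discarding the `u - l - 1` interior points, all below `S_(u)`, lowers its rank from `u` to `l +
1`. -/
theorem isRank_compl_upper {s : Fin n → unitInterval} {l u : ℕ} {T : Finset (Fin n)}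
    (hT : interior s l u = T) (hc : T.card = u - l - 1) (hlu : l < u) (hun : u ≤ n) :
    IsRank Tᶜ s (l + 1) (orderStat s u) := by
  refine (isRank_univ_add_card_iff_of_lt fun _ hm => (mem_interior.mp (hT ▸ hm)).2).mp ?_
  rw [show l + 1 + T.card = u by omega]
  exact isRank_orderStat s (by omega) hun

/-- The boundary points of a bin depend only on the scores that are not inside the bin. -/
theorem orderStat_eq_of_interior_eq {s s' : Fin n → unitInterval} {l u : ℕ} {T : Finset (Fin n)}
    (hT : interior s l u = T) (hT' : interior s' l u = T) (hc : T.card = u - l - 1)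
    (hlu : l < u) (hu : u ≤ n + 1) (hs : ∀ m ∉ T, s' m = s m) :
    orderStat s' l = orderStat s l ∧ orderStat s' u = orderStat s u := by
  have hs' : ∀ m ∈ Tᶜ, s' m = s m := fun m hm => hs m (Finset.mem_compl.mp hm)
  constructor
  · rcases Nat.eq_zero_or_pos l with rfl | hl
    · simp only [orderStat_zero]
    · exact (isRank_compl_lower hT' hl (by omega)).unique
        ((isRank_compl_lower hT hl (by omega)).congr hs')
  · rcases hu.eq_or_lt with rfl | hun
    · simp only [orderStat_last]
    · exact (isRank_compl_upper hT' hc hlu (by omega)).unique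
        ((isRank_compl_upper hT hc hlu (by omega)).congr hs')

/-- The scores inside a bin can be moved freely within the bin. -/
theorem interior_eq_of_forall_mem {s s' : Fin n → unitInterval} {l u : ℕ} {T : Finset (Fin n)}
    (hT : interior s l u = T) (hc : T.card = u - l - 1) (hlu : l < u) (hu : u ≤ n + 1)
    (hs : ∀ m ∉ T, s' m = s m)
    (hbox : ∀ m ∈ T, orderStat s l < s' m ∧ s' m < orderStat s u) :
    interior s' l u = T := by
  have hs' : ∀ m ∈ Tᶜ, s' m = s m := fun m hm => hs m (Finset.mem_compl.mp hm)
  -- The old endpoint keeps its rank among the frozen scores, and reinserting the moved points above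
  -- it does not affect that rank; uniqueness then identifies it with the new endpoint.
  have h1 : orderStat s' l = orderStat s l := by
    rcases Nat.eq_zero_or_pos l with rfl | hl
    · simp only [orderStat_zero]
    · exact (isRank_orderStat s' hl (by omega)).unique
        ((isRank_univ_iff_of_lt fun m hm => (hbox m hm).1).mpr
          ((isRank_compl_lower hT hl (by omega)).congr hs'))
  have h2 : orderStat s' u = orderStat s u := by
    rcases hu.eq_or_lt with rfl | hun
    · simp only [orderStat_last]
    · have := (isRank_univ_add_card_iff_of_lt fun m hm => (hbox m hm).2).mpr
        ((isRank_compl_upper hT hc hlu (by omega)).congr hs')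
      rw [show l + 1 + T.card = u by omega] at this
      exact (isRank_orderStat s' (by omega) (by omega)).unique this
  ext m
  rw [mem_interior, h1, h2]
  by_cases hm : m ∈ T
  · simp only [hm, hbox m hm, and_self]
  · rw [hs m hm, ← mem_interior, hT]

/-- Split according to the finitely many sorting permutations: on each piece the order statistic is
a coordinate, and the piece is cut out by inequalities and the tie-breaking rule of `Tuple.sort`. -/
theorem measurable_orderStat (k : ℕ) :
    Measurable fun s : Fin n → unitInterval => orderStat s k := by
  unfold orderStat
  split_ifs with h0 hk
  · exact measurable_const
  · intro V hV
    have : (fun s : Fin n → unitInterval => s (Tuple.sort s ⟨k - 1, hk⟩)) ⁻¹' V =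
        ⋃ σ : Equiv.Perm (Fin n), {s | σ = Tuple.sort s} ∩ {s | s (σ ⟨k - 1, hk⟩) ∈ V} := by
      ext s
      simp
    rw [this]
    refine MeasurableSet.iUnion fun σ => MeasurableSet.inter ?_ (measurable_pi_apply _ hV)
    simp only [Tuple.eq_sort_iff, Set.ofPred_and, Monotone, Set.ofPred_forall, Function.comp_apply]
    refine MeasurableSet.inter ?_ ?_
    · refine .iInter fun a => .iInter fun b => .iInter fun _ => ?_
      exact measurableSet_le (measurable_pi_apply _) (measurable_pi_apply _)
    · refine .iInter fun a => .iInter fun b => .iInter fun _ => ?_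
      by_cases hab : σ a < σ b
      · simp [hab]
      · simp only [hab, imp_false]
        exact (measurableSet_eq_fun (measurable_pi_apply (σ a)) (measurable_pi_apply (σ b))).compl
  · exact measurable_const

theorem measurableSet_interior_eq (l u : ℕ) (T : Finset (Fin n)) :
    MeasurableSet {s : Fin n → unitInterval | interior s l u = T} := by
  simp only [Finset.ext_iff, mem_interior, Set.ofPred_forall]
  refine .iInter fun m => ?_
  refine MeasurableSet.iff ?_ (MeasurableSet.const _)
  have hm : Measurable fun s : Fin n → unitInterval => s m := measurable_pi_apply m
  have hl : MeasurableSet {s : Fin n → unitInterval | orderStat s l < s m} :=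
    measurableSet_lt (measurable_orderStat l) hm
  have hu : MeasurableSet {s : Fin n → unitInterval | s m < orderStat s u} :=
    measurableSet_lt hm (measurable_orderStat u)
  exact hl.inter hu

end OrderStatistics

/-! ### Sections of product measures and Hoeffding's inequality on a box -/

section Concentration

variable {Z : Type*} [MeasurableSpace Z]

/-- An inequality between sections of two sets in the coordinates `T` can be integrated over the
remaining coordinates. -/
theorem pi_le_mul_pi_of_sections {ι : Type*} [Fintype ι] [DecidableEq ι] (P : Measure Z)
    [IsProbabilityMeasure P] (T : Finset ι) {E F : Set (ι → Z)} (hE : MeasurableSet E)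
    (hF : MeasurableSet F) (c : ENNReal)
    (h : ∀ w : {i // i ∉ T} → Z,
      Measure.pi (fun _ : {i // i ∈ T} => P)
          {x | (MeasurableEquiv.piEquivPiSubtypeProd (fun _ => Z) (· ∈ T)).symm (x, w) ∈ F} ≤
        c * Measure.pi (fun _ : {i // i ∈ T} => P)
          {x | (MeasurableEquiv.piEquivPiSubtypeProd (fun _ => Z) (· ∈ T)).symm (x, w) ∈ E}) :
    Measure.pi (fun _ : ι => P) F ≤ c * Measure.pi (fun _ : ι => P) E := by
  have hp := (measurePreserving_piEquivPiSubtypeProd (fun _ : ι => P) (· ∈ T)).symm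
  rw [← hp.measure_preimage hE.nullMeasurableSet, ← hp.measure_preimage hF.nullMeasurableSet,
    Measure.prod_apply_symm (hp.measurable hE), Measure.prod_apply_symm (hp.measurable hF),
    ← lintegral_const_mul _ (measurable_measure_prodMk_right (hp.measurable hE))]
  refine lintegral_mono fun w => ?_
  convert h w <;> rfl

theorem pi_smul_const {ι : Type*} [Fintype ι] (P : Measure Z) [IsProbabilityMeasure P]
    {c : ENNReal} (hc : c ≠ ⊤) :
    Measure.pi (fun _ : ι => c • P) = c ^ Fintype.card ι • Measure.pi (fun _ : ι => P) := by
  have : IsFiniteMeasure (c • P) := Measure.smul_finite P hc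
  refine Measure.pi_eq fun s _ => ?_
  simp [Measure.pi_pi, Finset.prod_mul_distrib]

/-- Two-sided Hoeffding inequality for the empirical mean of `[0, 1]`-valued variables. -/
theorem hoeffding_mean {ι : Type*} [Fintype ι] [Nonempty ι] (P : Measure Z)
    [IsProbabilityMeasure P] {f : Z → ℝ} (hf : Measurable f) (hf01 : ∀ z, f z ∈ Set.Icc (0 : ℝ) 1)
    {t : ℝ} (ht : 0 ≤ t) :
    Measure.pi (fun _ : ι => P)
        {x | t < |(∑ m, f (x m)) / (Fintype.card ι : ℝ) - ∫ z, f z ∂P|} ≤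
      ENNReal.ofReal (2 * Real.exp (-2 * Fintype.card ι * t ^ 2)) := by
  set k : ℝ := (Fintype.card ι : ℝ) with hk
  have hkpos : 0 < k := by
    rw [hk]
    exact_mod_cast Fintype.card_pos
  have hkt : 0 ≤ k * t := by positivity
  set μ := ∫ z, f z ∂P
  -- Hoeffding's lemma gives variance proxy 1/4 per term, so the exponent below is `-(k t)² / (2 ·
  -- k/4) = -2 k t²`.
  have hsub : HasSubgaussianMGF (fun z => f z - μ) ((‖(1 : ℝ) - 0‖₊ / 2) ^ 2) P :=
    hasSubgaussianMGF_of_mem_Icc hf.aemeasurable (Filter.Eventually.of_forall hf01)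
  have hsub' := hsub.neg
  have hev : ∀ m : ι, MeasurePreserving (Function.eval m) (Measure.pi fun _ : ι => P) P :=
    fun m => measurePreserving_eval _ m
  have hlift : ∀ (φ : Z → ℝ) (c : NNReal), Measurable φ → HasSubgaussianMGF φ c P →
      ∀ m : ι, HasSubgaussianMGF (fun x : ι → Z => φ (x m)) c (Measure.pi fun _ : ι => P) := by
    intro φ c hφ h m
    refine HasSubgaussianMGF.of_map (mΩ := inferInstance) (Y := fun x : ι → Z => x m) (X := φ) ?_ ?_
    · exact (measurable_pi_apply m).aemeasurable
    · have : (Measure.pi fun _ : ι => P).map (fun x => x m) = P := (hev m).map_eq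
      rwa [this]
  have key : ∀ φ : Z → ℝ, Measurable φ → HasSubgaussianMGF φ ((‖(1 : ℝ) - 0‖₊ / 2) ^ 2) P →
      (Measure.pi fun _ : ι => P).real {x | k * t ≤ ∑ m, φ (x m)} ≤
        Real.exp (-2 * k * t ^ 2) := by
    intro φ hφ h
    have := HasSubgaussianMGF.measure_sum_ge_le_of_iIndepFun
      (iIndepFun_pi (μ := fun _ : ι => P) (X := fun _ => φ) fun _ => hφ.aemeasurable)
      (s := Finset.univ) (fun m _ => hlift φ _ hφ h m) hkt
    refine this.trans (Real.exp_le_exp.mpr (le_of_eq ?_))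
    simp only [sub_zero, nnnorm_one, Finset.sum_const, Finset.card_univ, nsmul_eq_mul]
    push_cast
    rw [← hk]
    field_simp
  have h1 := key _ (hf.sub_const μ) hsub
  have h2 := key _ (hf.sub_const μ).neg hsub'
  have hsubset : {x : ι → Z | t < |(∑ m, f (x m)) / k - μ|} ⊆
      {x | k * t ≤ ∑ m, (f (x m) - μ)} ∪ {x | k * t ≤ ∑ m, -(f (x m) - μ)} := by
    intro x hx
    have hx : t < |(∑ m, f (x m)) / k - μ| := hx
    have hsum : ∑ m, (f (x m) - μ) = k * ((∑ m, f (x m)) / k - μ) := by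
      rw [Finset.sum_sub_distrib]
      simp only [Finset.sum_const, Finset.card_univ, nsmul_eq_mul]
      rw [← hk]
      field_simp
    rcases lt_abs.mp hx with h | h
    · left
      change k * t ≤ ∑ m, (f (x m) - μ)
      rw [hsum]
      exact mul_le_mul_of_nonneg_left h.le hkpos.le
    · right
      change k * t ≤ ∑ m, -(f (x m) - μ)
      rw [Finset.sum_neg_distrib, hsum, ← mul_neg]
      exact mul_le_mul_of_nonneg_left h.le hkpos.le
  rw [← ofReal_measureReal]
  refine ENNReal.ofReal_le_ofReal ?_
  calc _ ≤ _ := measureReal_mono hsubset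
    _ ≤ _ := measureReal_union_le _ _
    _ ≤ Real.exp (-2 * k * t ^ 2) + Real.exp (-2 * k * t ^ 2) := add_le_add h1 h2
    _ = _ := by ring

/-- Hoeffding's inequality for the mean of points that are conditioned to lie in `I`. -/
theorem hoeffding_box {ι : Type*} [Fintype ι] [Nonempty ι] (P : Measure Z)
    [IsProbabilityMeasure P] {f : Z → ℝ} (hf : Measurable f) (hf01 : ∀ z, f z ∈ Set.Icc (0 : ℝ) 1)
    {t : ℝ} (ht : 0 ≤ t) (I : Set Z) :
    Measure.pi (fun _ : ι => P)
        {x | (∀ m, x m ∈ I) ∧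
          t * P.real I < |(∑ m, f (x m)) / (Fintype.card ι : ℝ) * P.real I - ∫ z in I, f z ∂P|} ≤
      ENNReal.ofReal (2 * Real.exp (-2 * Fintype.card ι * t ^ 2)) *
        Measure.pi (fun _ : ι => P) {x | ∀ m, x m ∈ I} := by
  -- On a null box both sides of the deviation inequality vanish, so the strict event is empty.
  by_cases h0 : P I = 0
  · have : P.real I = 0 := by simp [Measure.real, h0]
    simp [this, setIntegral_measure_zero _ h0]
  have hpos : 0 < P.real I := by
    rw [Measure.real]
    exact ENNReal.toReal_pos h0 (measure_ne_top _ _)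
  have := cond_isProbabilityMeasure h0
  -- Hence the product measure restricted to the box is `P(I)^k`, the mass of the box, times the
  -- product of the conditional laws, and the unconditional Hoeffding bound applies to `P[|I]`.
  have hres : P.restrict I = P I • P[|I] := by
    rw [ProbabilityTheory.cond, smul_smul, ENNReal.mul_inv_cancel h0 (measure_ne_top _ _), one_smul]
  have hbox : {x : ι → Z | ∀ m, x m ∈ I} = Set.univ.pi fun _ => I := by
    ext x
    simp
  have hmean : ∫ z, f z ∂P[|I] = (∫ z in I, f z ∂P) / P.real I := by
    rw [ProbabilityTheory.cond, integral_smul_measure]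
    simp [Measure.real, div_eq_inv_mul]
  have hmeas : MeasurableSet {x : ι → Z |
      t < |(∑ m, f (x m)) / (Fintype.card ι : ℝ) - ∫ z, f z ∂P[|I]|} := by
    refine measurableSet_lt measurable_const ?_
    fun_prop
  have hset : {x : ι → Z | (∀ m, x m ∈ I) ∧
      t * P.real I < |(∑ m, f (x m)) / (Fintype.card ι : ℝ) * P.real I - ∫ z in I, f z ∂P|} =
      {x | t < |(∑ m, f (x m)) / (Fintype.card ι : ℝ) - ∫ z, f z ∂P[|I]|} ∩
        Set.univ.pi fun _ => I := by
    rw [← hbox]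
    ext x
    simp only [Set.mem_inter_iff, Set.mem_ofPred_eq]
    rw [and_comm]
    refine and_congr_left fun _ => ?_
    rw [hmean, show (∑ m, f (x m)) / (Fintype.card ι : ℝ) * P.real I - ∫ z in I, f z ∂P =
      ((∑ m, f (x m)) / (Fintype.card ι : ℝ) - (∫ z in I, f z ∂P) / P.real I) * P.real I by
        field_simp, abs_mul, abs_of_pos hpos, mul_lt_mul_iff_left₀ hpos]
  rw [hset, ← Measure.restrict_apply hmeas, Measure.restrict_pi_pi, hres,
    pi_smul_const _ (measure_ne_top _ _), hbox, Measure.pi_pi, Measure.smul_apply, smul_eq_mul,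
    mul_comm]
  simp only [Finset.prod_const, Finset.card_univ]
  gcongr
  exact hoeffding_mean _ hf hf01 ht

end Concentration

/-! ### Concentration inside a data-dependent bin -/

section BinConcentration

variable {𝒳 : Type*} [MeasurableSpace 𝒳]

/-- The scores of a data set. -/
def scores {n : ℕ} (g : Predictor 𝒳) (D : Dataset 𝒳 n) : Fin n → unitInterval :=
  fun i => g.1 (D i).1

/-- The pairs whose score lies strictly between `a` and `b`. -/
def openBin (g : Predictor 𝒳) (a b : unitInterval) : Set (𝒳 × unitInterval) :=
  {z | a < g.1 z.1 ∧ g.1 z.1 < b}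

theorem measurable_score (g : Predictor 𝒳) :
    Measurable fun z : 𝒳 × unitInterval => g.1 z.1 :=
  g.2.comp measurable_fst

theorem measurable_scores {n : ℕ} (g : Predictor 𝒳) :
    Measurable fun D : Dataset 𝒳 n => scores g D :=
  measurable_pi_lambda _ fun i => (measurable_score g).comp (measurable_pi_apply i)

theorem measurable_label : Measurable fun z : 𝒳 × unitInterval => (z.2 : ℝ) :=
  measurable_subtype_coe.comp measurable_snd

/-- Joint measurability in endpoints and point makes the mass and the label integral of a bin
measurable in its endpoints, which are random later on. -/
theorem measurableSet_openBin_graph (g : Predictor 𝒳) :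
    MeasurableSet {q : (unitInterval × unitInterval) × (𝒳 × unitInterval) |
      q.2 ∈ openBin g q.1.1 q.1.2} := by
  have hg : Measurable fun q : (unitInterval × unitInterval) × (𝒳 × unitInterval) => g.1 q.2.1 :=
    (measurable_score g).comp measurable_snd
  have h1 : MeasurableSet {q : (unitInterval × unitInterval) × (𝒳 × unitInterval) |
      q.1.1 < g.1 q.2.1} := measurableSet_lt (measurable_fst.comp measurable_fst) hg
  have h2 : MeasurableSet {q : (unitInterval × unitInterval) × (𝒳 × unitInterval) |
      g.1 q.2.1 < q.1.2} := measurableSet_lt hg (measurable_snd.comp measurable_fst)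
  exact h1.inter h2

theorem measurableSet_openBin (g : Predictor 𝒳) (a b : unitInterval) :
    MeasurableSet (openBin g a b) :=
  measurable_prodMk_left (x := (a, b)) (measurableSet_openBin_graph g)

theorem measurable_measureReal_openBin (g : Predictor 𝒳) (P : Measure (𝒳 × unitInterval))
    [IsProbabilityMeasure P] :
    Measurable fun q : unitInterval × unitInterval => P.real (openBin g q.1 q.2) :=
  (measurable_measure_prodMk_left (measurableSet_openBin_graph g)).ennreal_toReal

theorem measurable_integral_openBin (g : Predictor 𝒳) (P : Measure (𝒳 × unitInterval))
    [IsProbabilityMeasure P] :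
    Measurable fun q : unitInterval × unitInterval => ∫ z in openBin g q.1 q.2, (z.2 : ℝ) ∂P := by
  have h : StronglyMeasurable fun q : (unitInterval × unitInterval) × (𝒳 × unitInterval) =>
      Set.indicator {q : (unitInterval × unitInterval) × (𝒳 × unitInterval) |
        q.2 ∈ openBin g q.1.1 q.1.2} (fun q => (q.2.2 : ℝ)) q :=
    ((measurable_label.comp measurable_snd).indicator
      (measurableSet_openBin_graph g)).stronglyMeasurable
  have := (h.integral_prod_right' (ν := P)).measurable
  convert this using 2 with q
  rw [← integral_indicator (measurableSet_openBin g _ _)]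
  rfl

theorem measure_score_eq (g : Predictor 𝒳) (P : Measure (𝒳 × unitInterval))
    (hg : P.map (fun z => (g.1 z.1 : ℝ)) ≪ (volume : Measure ℝ)) (c : unitInterval) :
    P {z | g.1 z.1 = c} = 0 := by
  have hm : Measurable fun z : 𝒳 × unitInterval => (g.1 z.1 : ℝ) :=
    measurable_subtype_coe.comp (measurable_score g)
  have h : P.map (fun z => (g.1 z.1 : ℝ)) {(c : ℝ)} = 0 := hg (by simp)
  rw [Measure.map_apply hm (measurableSet_singleton _)] at h
  convert h using 2
  ext z
  simp [Subtype.ext_iff]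

/-- A score has no atoms, which excludes 0 and 1. Two scores are independent, and the diagonal is
null for the product of their laws because its sections are singletons. -/
theorem ae_scores_generic {n : ℕ} (g : Predictor 𝒳) (P : Measure (𝒳 × unitInterval))
    [IsProbabilityMeasure P] (hg : P.map (fun z => (g.1 z.1 : ℝ)) ≪ (volume : Measure ℝ)) :
    ∀ᵐ D ∂Measure.pi (fun _ : Fin n => P), Function.Injective (scores g D) ∧
      ∀ m, 0 < scores g D m ∧ scores g D m < 1 := by
  have hne : ∀ c : unitInterval, ∀ᵐ z ∂P, g.1 z.1 ≠ c := fun c => by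
    rw [ae_iff]
    simpa using measure_score_eq g P hg c
  have hpt : ∀ (m : Fin n) (c : unitInterval),
      ∀ᵐ D ∂Measure.pi (fun _ : Fin n => P), scores g D m ≠ c := fun m c =>
    (Measure.quasiMeasurePreserving_eval (fun _ : Fin n => P) m).ae (hne c)
  have hpair : ∀ i j : Fin n, i ≠ j →
      ∀ᵐ D ∂Measure.pi (fun _ : Fin n => P), scores g D i ≠ scores g D j := by
    intro i j hij
    have hind := (iIndepFun_pi (μ := fun _ : Fin n => P)
      (X := fun _ z => g.1 z.1) fun _ => (measurable_score g).aemeasurable).indepFun hij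
    have hmi : ∀ m : Fin n, Measurable fun D : Fin n → 𝒳 × unitInterval => g.1 (D m).1 :=
      fun m => (measurable_score g).comp (measurable_pi_apply m)
    rw [indepFun_iff_map_prod_eq_prod_map_map (hmi i).aemeasurable (hmi j).aemeasurable] at hind
    have hdiag : MeasurableSet {p : unitInterval × unitInterval | p.1 = p.2} :=
      measurableSet_eq_fun measurable_fst measurable_snd
    have hfin : ∀ m : Fin n, IsProbabilityMeasure
        (Measure.map (fun D : Fin n → 𝒳 × unitInterval => g.1 (D m).1)
          (Measure.pi fun _ : Fin n => P)) :=
      fun m => Measure.isProbabilityMeasure_map (hmi m).aemeasurable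
    have hzero : Measure.map (fun D : Fin n → 𝒳 × unitInterval => (g.1 (D i).1, g.1 (D j).1))
        (Measure.pi fun _ : Fin n => P) {p | p.1 = p.2} = 0 := by
      have := hfin i
      have := hfin j
      rw [hind, Measure.measure_prod_null hdiag]
      refine Filter.Eventually.of_forall fun c => ?_
      beta_reduce
      have hpre : Prod.mk c ⁻¹' {p : unitInterval × unitInterval | p.1 = p.2} = {c} := by
        ext d
        simp [eq_comm]
      rw [hpre, Measure.map_apply (hmi j) (measurableSet_singleton c)]
      have := hpt j c
      rw [ae_iff] at this
      simp only [ne_eq, not_not] at this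
      exact this
    rw [Measure.map_apply ((hmi i).prodMk (hmi j)) hdiag] at hzero
    rw [ae_iff]
    simpa [scores] using hzero
  have hpair' : ∀ᵐ D ∂Measure.pi (fun _ : Fin n => P),
      ∀ i j : Fin n, i ≠ j → scores g D i ≠ scores g D j := by
    simp only [ae_all_iff]
    exact hpair
  have h0 : ∀ᵐ D ∂Measure.pi (fun _ : Fin n => P), ∀ m : Fin n, scores g D m ≠ 0 :=
    ae_all_iff.mpr fun m => hpt m 0
  have h1 : ∀ᵐ D ∂Measure.pi (fun _ : Fin n => P), ∀ m : Fin n, scores g D m ≠ 1 :=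
    ae_all_iff.mpr fun m => hpt m 1
  filter_upwards [hpair', h0, h1] with D hD hD0 hD1
  refine ⟨fun i j hij => by_contra fun hne => hD i j hne hij, fun m => ⟨?_, ?_⟩⟩
  · exact lt_of_le_of_ne unitInterval.nonneg' (hD0 m).symm
  · exact lt_of_le_of_ne unitInterval.le_one' (hD1 m)

/-- The deviation event of the bin with boundary ranks `l` and `u` whose inner points are `T`. -/
theorem measure_deviation_on_interior_le {n : ℕ} (g : Predictor 𝒳)
    (P : Measure (𝒳 × unitInterval)) [IsProbabilityMeasure P] {l u : ℕ} (hlu : l + 1 < u)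
    (hu : u ≤ n + 1) {t : ℝ} (ht : 0 ≤ t) (T : Finset (Fin n)) (hT : T.card = u - l - 1) :
    Measure.pi (fun _ : Fin n => P)
        {D | interior (scores g D) l u = T ∧
          t * P.real (openBin g (orderStat (scores g D) l) (orderStat (scores g D) u)) <
            |(∑ m ∈ T, ((D m).2 : ℝ)) / (T.card : ℝ) *
                P.real (openBin g (orderStat (scores g D) l) (orderStat (scores g D) u)) -
              ∫ z in openBin g (orderStat (scores g D) l) (orderStat (scores g D) u),
                (z.2 : ℝ) ∂P|} ≤
      ENNReal.ofReal (2 * Real.exp (-2 * T.card * t ^ 2)) *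
        Measure.pi (fun _ : Fin n => P) {D | interior (scores g D) l u = T} := by
  have hE : MeasurableSet {D : Dataset 𝒳 n | interior (scores g D) l u = T} :=
    measurable_scores g (measurableSet_interior_eq l u T)
  have hab : Measurable fun D : Dataset 𝒳 n =>
      (orderStat (scores g D) l, orderStat (scores g D) u) :=
    ((measurable_orderStat l).comp (measurable_scores g)).prodMk
      ((measurable_orderStat u).comp (measurable_scores g))
  have hq := (measurable_measureReal_openBin g P).comp hab
  have hv := (measurable_integral_openBin g P).comp hab
  have hsum : Measurable fun D : Dataset 𝒳 n => (∑ m ∈ T, ((D m).2 : ℝ)) / (T.card : ℝ) :=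
    (Finset.measurable_sum _ fun m _ =>
      measurable_label.comp (measurable_pi_apply m)).div_const _
  have hdev : MeasurableSet {D : Dataset 𝒳 n |
      t * P.real (openBin g (orderStat (scores g D) l) (orderStat (scores g D) u)) <
        |(∑ m ∈ T, ((D m).2 : ℝ)) / (T.card : ℝ) *
            P.real (openBin g (orderStat (scores g D) l) (orderStat (scores g D) u)) -
          ∫ z in openBin g (orderStat (scores g D) l) (orderStat (scores g D) u),
            (z.2 : ℝ) ∂P|} := by
    have := ((hsum.mul hq).sub hv).norm
    exact measurableSet_lt (hq.const_mul t) this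
  refine pi_le_mul_pi_of_sections P T hE (hE.inter hdev) _ fun w => ?_
  have : Nonempty {i // i ∈ T} := by
    obtain ⟨m, hm⟩ := Finset.card_pos.mp (by omega : 0 < T.card)
    exact ⟨⟨m, hm⟩⟩
  set G : ({i // i ∈ T} → 𝒳 × unitInterval) → Dataset 𝒳 n := fun x =>
    (MeasurableEquiv.piEquivPiSubtypeProd (fun _ => 𝒳 × unitInterval) (· ∈ T)).symm (x, w) with hG
  have hGin : ∀ x (m : {i // i ∈ T}), G x m = x m := fun x m => by
    have : G x m = if h : (m : Fin n) ∈ T then x ⟨m, h⟩ else w ⟨m, h⟩ := rfl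
    rw [this, dif_pos m.2]
  have hGout : ∀ x x' m, m ∉ T → G x' m = G x m := fun x x' m hm => by
    have h : ∀ x, G x m = if h : m ∈ T then x ⟨m, h⟩ else w ⟨m, h⟩ := fun _ => rfl
    rw [h, h, dif_neg hm, dif_neg hm]
  -- If the section over `w` is nonempty, one reference point `x₀` fixes the endpoints `a`, `b` for
  -- the whole section, which is then the box of the open bin. Otherwise there is nothing to bound.
  by_cases hne : ∃ x₀, interior (scores g (G x₀)) l u = T
  · obtain ⟨x₀, hx₀⟩ := hne
    set a := orderStat (scores g (G x₀)) l with ha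
    set b := orderStat (scores g (G x₀)) u with hb
    have hout : ∀ x, ∀ m ∉ T, scores g (G x) m = scores g (G x₀) m := fun x m hm => by
      simp only [scores, hGout x₀ x m hm]
    have hbd : ∀ x, interior (scores g (G x)) l u = T →
        orderStat (scores g (G x)) l = a ∧ orderStat (scores g (G x)) u = b := fun x hx =>
      orderStat_eq_of_interior_eq hx₀ hx hT (by omega) hu (hout x)
    have hsec : {x | G x ∈ {D : Dataset 𝒳 n | interior (scores g D) l u = T}} =
        {x | ∀ m, x m ∈ openBin g a b} := by
      ext x
      constructor
      · intro hx m
        have hx : interior (scores g (G x)) l u = T := hx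
        obtain ⟨h1, h2⟩ := hbd x hx
        have := mem_interior.mp (hx.symm ▸ m.2 : (m : Fin n) ∈ interior (scores g (G x)) l u)
        rw [h1, h2, scores, hGin] at this
        exact this
      · intro hx
        refine interior_eq_of_forall_mem hx₀ hT (by omega) hu (hout x) fun m hm => ?_
        have := hx ⟨m, hm⟩
        rw [← hGin x ⟨m, hm⟩] at this
        exact this
    have hHoeff := hoeffding_box (ι := {i // i ∈ T}) P measurable_label
      (fun z => z.2.2) ht (openBin g a b)
    rw [Fintype.card_coe] at hHoeff
    refine le_trans (measure_mono ?_) (hHoeff.trans_eq (by rw [← hsec]))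
    rintro x ⟨hx1, hx2⟩
    have hx1 : interior (scores g (G x)) l u = T := hx1
    obtain ⟨h1, h2⟩ := hbd x hx1
    refine ⟨hsec.subset hx1, ?_⟩
    have hx2 : t * P.real (openBin g (orderStat (scores g (G x)) l)
        (orderStat (scores g (G x)) u)) < |(∑ m ∈ T, ((G x m).2 : ℝ)) / (T.card : ℝ) *
            P.real (openBin g (orderStat (scores g (G x)) l) (orderStat (scores g (G x)) u)) -
          ∫ z in openBin g (orderStat (scores g (G x)) l) (orderStat (scores g (G x)) u),
            (z.2 : ℝ) ∂P| := hx2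
    rw [h1, h2, ← Finset.sum_coe_sort T] at hx2
    simpa only [hGin] using hx2
  · refine le_trans (le_of_eq ?_) zero_le
    convert measure_empty (μ := Measure.pi fun _ : {i // i ∈ T} => P)
    refine Set.eq_empty_of_forall_notMem fun x hx => hne ⟨x, hx.1⟩

/-- The mean label of the points strictly inside the bin with boundary ranks `l` and `u`
concentrates around the conditional mean of the label given that the score is in the bin. -/
theorem measure_deviation_le {n : ℕ} (g : Predictor 𝒳)
    (P : Measure (𝒳 × unitInterval)) [IsProbabilityMeasure P]
    (hg : P.map (fun z => (g.1 z.1 : ℝ)) ≪ (volume : Measure ℝ)) {l u : ℕ} (hlu : l + 1 < u)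
    (hu : u ≤ n + 1) {t : ℝ} (ht : 0 ≤ t) :
    Measure.pi (fun _ : Fin n => P)
        {D | t * P.real (openBin g (orderStat (scores g D) l) (orderStat (scores g D) u)) <
            |(∑ r ∈ Finset.Ioo l u, (orderedLabel (scores g D) (fun i => (D i).2) r : ℝ)) /
                ((u - l - 1 : ℕ) : ℝ) *
                P.real (openBin g (orderStat (scores g D) l) (orderStat (scores g D) u)) -
              ∫ z in openBin g (orderStat (scores g D) l) (orderStat (scores g D) u),
                (z.2 : ℝ) ∂P|} ≤
      ENNReal.ofReal (2 * Real.exp (-2 * ((u - l - 1 : ℕ) : ℝ) * t ^ 2)) := by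
  set Q := Measure.pi fun _ : Fin n => P
  set E : Finset (Fin n) → Set (Dataset 𝒳 n) := fun T => {D | interior (scores g D) l u = T}
    with hEdef
  set F : Finset (Fin n) → Set (Dataset 𝒳 n) := fun T =>
    {D | interior (scores g D) l u = T ∧
      t * P.real (openBin g (orderStat (scores g D) l) (orderStat (scores g D) u)) <
        |(∑ m ∈ T, ((D m).2 : ℝ)) / (T.card : ℝ) *
            P.real (openBin g (orderStat (scores g D) l) (orderStat (scores g D) u)) -
          ∫ z in openBin g (orderStat (scores g D) l) (orderStat (scores g D) u),
            (z.2 : ℝ) ∂P|} with hFdef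
  set I : Finset (Finset (Fin n)) := Finset.univ.filter fun T => T.card = u - l - 1 with hI
  set c := ENNReal.ofReal (2 * Real.exp (-2 * ((u - l - 1 : ℕ) : ℝ) * t ^ 2)) with hc
  have hF : ∀ T ∈ I, Q (F T) ≤ c * Q (E T) := fun T hT => by
    have hT' : T.card = u - l - 1 := (Finset.mem_filter.mp hT).2
    have := measure_deviation_on_interior_le g P hlu hu ht T hT'
    rw [hc, ← hT']
    exact this
  -- Almost surely the interior has exactly `u - l - 1` points, so sets `T` of that size suffice and
  -- all share the same Hoeffding constant.
  calc _ ≤ Q (⋃ T ∈ I, F T) := by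
        refine measure_mono_ae ?_
        filter_upwards [ae_scores_generic (n := n) g P hg] with D hD hbad
        have hcard := card_interior_of_injective hD.1 (fun m => (hD.2 m).1)
          (fun m => (hD.2 m).2) (l := l) hu
        refine Set.mem_iUnion₂.mpr ⟨interior (scores g D) l u, ?_, rfl, ?_⟩
        · exact Finset.mem_filter.mpr ⟨Finset.mem_univ _, hcard⟩
        · rw [← sum_orderedLabel_Ioo (scores g D) (fun i => (D i).2) hcard, hcard]
          exact hbad
    _ ≤ ∑ T ∈ I, Q (F T) := measure_biUnion_finset_le _ _
    _ ≤ ∑ T ∈ I, c * Q (E T) := Finset.sum_le_sum hF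
    _ = c * ∑ T ∈ I, Q (E T) := by rw [Finset.mul_sum]
    -- The events `E T` are disjoint, so the number of candidate sets `T` costs nothing.
    _ ≤ c * 1 := by
        gcongr
        refine (sum_measure_le_measure_univ (s := I) (t := E) (fun T _ => ?_) ?_).trans_eq
          measure_univ
        · exact (measurable_scores g (measurableSet_interior_eq l u T)).nullMeasurableSet
        · intro T _ T' _ hne
          refine Disjoint.aedisjoint (Set.disjoint_left.mpr fun D h h' => hne ?_)
          exact Eq.trans (Eq.symm h) h'
    _ = c := mul_one c

end BinConcentration

/-! ### From level-set bounds to calibration and ECE -/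

section Calibrated

variable {𝒳 : Type*} [MeasurableSpace 𝒳]

theorem integrable_label (P : Measure (𝒳 × unitInterval)) [IsProbabilityMeasure P] :
    Integrable (fun z : 𝒳 × unitInterval => (z.2 : ℝ)) P :=
  Integrable.of_mem_Icc 0 1 measurable_label.aemeasurable
    (Filter.Eventually.of_forall fun z => z.2.2)

/-- A predictor with finitely many values is calibrated if it is so on each of its level sets. -/
theorem approxCalibrated_of_levelSets (P : Measure (𝒳 × unitInterval)) [IsProbabilityMeasure P]
    (h : Predictor 𝒳) {ε : ℝ} (hε : 0 ≤ ε) (hfin : (Set.range h.1).Finite)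
    (hr : ∀ r : unitInterval, |∫ z in {z : 𝒳 × unitInterval | h.1 z.1 = r}, ((z.2 : ℝ) - r) ∂P| ≤
      ε * P.real {z | h.1 z.1 = r}) :
    ApproxCalibrated P h ε := by
  have hm := (measurable_score h).comap_le
  have hlev : ∀ r : unitInterval, MeasurableSet {z : 𝒳 × unitInterval | h.1 z.1 = r} := fun r =>
    measurable_score h (measurableSet_singleton r)
  obtain ⟨ψ, -, hψ⟩ := (stronglyMeasurable_condExp (μ := P)
    (f := fun z : 𝒳 × unitInterval => (z.2 : ℝ))
    (m := MeasurableSpace.comap (fun z : 𝒳 × unitInterval => h.1 z.1)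
      inferInstance)).exists_eq_measurable_comp
  have hψ' : ∀ z, condMean P h z = ψ (h.1 z.1) := fun z => congrFun hψ z
  classical
  -- On values of probability zero `ψ` is uncontrolled, so it is replaced there by `r` itself, with
  -- error 0. As `φ` differs from the inclusion only on the finite range of `h`, it is measurable.
  let φ : unitInterval → ℝ := fun r =>
    if r ∈ Set.range h.1 ∧ P {z | h.1 z.1 = r} ≠ 0 then ψ r else r
  refine ⟨φ, ⟨?_, ?_⟩, ?_⟩
  · refine measurable_subtype_coe.measurable_of_countable_ne (hfin.countable.mono ?_)
    intro r hne
    by_contra hrange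
    exact hne (if_neg fun hh => hrange hh.1).symm
  · have hnull : ∀ᵐ z ∂P, ∀ r ∈ hfin.toFinset, P {z | h.1 z.1 = r} = 0 → h.1 z.1 ≠ r := by
      rw [Finset.eventually_all]
      intro r _
      by_cases h0 : P {z | h.1 z.1 = r} = 0
      · have : ∀ᵐ z ∂P, h.1 z.1 ≠ r := by
          rw [ae_iff]
          simpa using h0
        filter_upwards [this] with z hz _ using hz
      · exact Filter.Eventually.of_forall fun z h0' => absurd h0' h0
    filter_upwards [hnull] with z hz
    rw [hψ']
    have hmem : h.1 z.1 ∈ Set.range h.1 := ⟨z.1, rfl⟩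
    exact if_pos ⟨hmem, fun h0 => hz _ (hfin.mem_toFinset.mpr hmem) h0 rfl⟩
  · intro r hrange
    by_cases h0 : P {z | h.1 z.1 = r} = 0
    · have : φ r = r := if_neg fun hh => hh.2 h0
      rw [this, sub_self, abs_zero]
      exact hε
    · have hφ : φ r = ψ r := if_pos ⟨hrange, h0⟩
      have hpos : 0 < P.real {z | h.1 z.1 = r} :=
        ENNReal.toReal_pos h0 (measure_ne_top _ _)
      have h1 : ∫ z in {z | h.1 z.1 = r}, condMean P h z ∂P =
          ∫ z in {z | h.1 z.1 = r}, (z.2 : ℝ) ∂P :=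
        setIntegral_condExp hm (integrable_label P) ⟨{r}, measurableSet_singleton r, rfl⟩
      have h2 : ∫ z in {z | h.1 z.1 = r}, condMean P h z ∂P =
          P.real {z | h.1 z.1 = r} * ψ r := by
        rw [setIntegral_congr_fun (hlev r) (g := fun _ => ψ r), setIntegral_const, smul_eq_mul]
        intro z hz
        rw [hψ', show h.1 z.1 = r from hz]
      have h3 : ∫ z in {z : 𝒳 × unitInterval | h.1 z.1 = r}, ((z.2 : ℝ) - r) ∂P =
          (ψ r - r) * P.real {z | h.1 z.1 = r} := by
        rw [integral_sub (integrable_label P).integrableOn (integrable_const _), ← h1, h2,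
          setIntegral_const, smul_eq_mul]
        ring
      have h4 := hr r
      rw [h3, abs_mul, abs_of_pos hpos] at h4
      rw [hφ]
      exact le_of_mul_le_mul_right h4 hpos

/-- Since `h(X)` always lies in the range of `h`, the integrand is almost surely at most `ε ^ p`.
The hypothesis does not involve `p`, so one event serves all exponents. -/
theorem ApproxCalibrated.ece_le {P : Measure (𝒳 × unitInterval)} [IsProbabilityMeasure P]
    {h : Predictor 𝒳} {ε : ℝ} (hh : ApproxCalibrated P h ε) (hε : 0 ≤ ε) {p : ℝ} (hp : 1 ≤ p) :
    ece P h p ≤ ε := by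
  obtain ⟨φ, ⟨-, hφ⟩, hb⟩ := hh
  have hp0 : 0 < p := by linarith
  have hbound : ∀ᵐ z ∂P, |condMean P h z - (h.1 z.1 : ℝ)| ^ p ≤ ε ^ p := by
    filter_upwards [hφ] with z hz
    rw [← hz]
    exact Real.rpow_le_rpow (abs_nonneg _) (hb _ ⟨z.1, rfl⟩) hp0.le
  have hnn : ∀ z, 0 ≤ |condMean P h z - (h.1 z.1 : ℝ)| ^ p := fun z =>
    Real.rpow_nonneg (abs_nonneg _) _
  have hint : ∫ z, |condMean P h z - (h.1 z.1 : ℝ)| ^ p ∂P ≤ ε ^ p := by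
    calc _ ≤ ∫ _z, ε ^ p ∂P :=
          integral_mono_of_nonneg (Filter.Eventually.of_forall hnn) (integrable_const _) hbound
      _ = ε ^ p := by simp
  unfold ece
  calc _ ≤ (ε ^ p) ^ (1 / p) :=
        Real.rpow_le_rpow (integral_nonneg hnn) hint (by positivity)
    _ = ε := by rw [one_div, Real.rpow_rpow_inv hε hp0.ne']

end Calibrated

/-! ### Bin sizes and the effect of the right endpoint -/

section Bins

theorem boundary_zero (n B : ℕ) : boundary n B 0 = 0 := by
  simp [boundary]

theorem boundary_last (n : ℕ) {B : ℕ} (hB : 1 ≤ B) : boundary n B B = n + 1 := by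
  have : (B : ℚ) ≠ 0 := by positivity
  rw [boundary, mul_div_cancel₀ _ this]
  exact_mod_cast Nat.ceil_natCast (R := ℚ) (n + 1)

/-- An integer shift passes through the ceiling, and `⌊n/B⌋ ≤ (n+1)/B`. -/
theorem boundary_add_div_le (n B b : ℕ) : boundary n B b + n / B ≤ boundary n B (b + 1) := by
  unfold boundary
  rw [← Nat.ceil_add_natCast (by positivity)]
  gcongr
  have : ((n / B : ℕ) : ℚ) ≤ ((n : ℚ) + 1) / B :=
    Nat.cast_div_le.trans (by gcongr; linarith)
  push_cast
  linarith

variable {n : ℕ}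

theorem binnedScore_eq {B b : ℕ} (hb : b ∈ Finset.Icc 1 B) (s y : Fin n → unitInterval)
    {t : unitInterval} (h1 : orderStat s (boundary n B (b - 1)) ≤ t)
    (h2 : t < orderStat s (boundary n B b)) : binnedScore B s y t = biasEstimate B s y b := by
  unfold binnedScore
  rw [Finset.sum_eq_single_of_mem b hb, if_pos ⟨h1, h2⟩]
  intro c hc hcb
  refine if_neg ?_
  rintro ⟨h3, h4⟩
  have hm := (orderStat_mono s).comp (boundary_mono n B)
  rw [Finset.mem_Icc] at hb hc
  rcases lt_or_gt_of_ne hcb with hlt | hlt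
  · exact (h4.trans_le ((hm (show c ≤ b - 1 by omega)).trans h1)).false
  · exact (h2.trans_le ((hm (show b ≤ c - 1 by omega)).trans h3)).false

theorem exists_bin {B : ℕ} (hB : 1 ≤ B) (s : Fin n → unitInterval) {t : unitInterval}
    (ht : t < 1) : ∃ b ∈ Finset.Icc 1 B, orderStat s (boundary n B (b - 1)) ≤ t ∧
      t < orderStat s (boundary n B b) := by
  classical
  have hlast : t < orderStat s (boundary n B B) := by
    rwa [boundary_last n hB, orderStat_last]
  have hex : ∃ b, t < orderStat s (boundary n B b) := ⟨B, hlast⟩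
  have hspec := Nat.find_spec hex
  have hpos : 1 ≤ Nat.find hex := by
    by_contra! h0
    rw [Nat.lt_one_iff.mp h0, boundary_zero, orderStat_zero] at hspec
    exact hspec.not_ge unitInterval.nonneg'
  refine ⟨Nat.find hex, Finset.mem_Icc.mpr ⟨hpos, ?_⟩, ?_, hspec⟩
  · exact Nat.find_min' hex hlast
  · exact not_lt.mp (Nat.find_min hex (by omega))

/-- The difference equals `(y - S/k)/(k+1)`, and both `y` and the mean `S/k` lie in `[0, 1]`. -/
theorem abs_mean_insert_sub_mean_le {k : ℕ} (hk : 1 ≤ k) {S y : ℝ} (hS0 : 0 ≤ S) (hSk : S ≤ k)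
    (hy0 : 0 ≤ y) (hy1 : y ≤ 1) : |(S + y) / ((k : ℝ) + 1) - S / k| ≤ 1 / ((k : ℝ) + 1) := by
  have hk' : (0 : ℝ) < k := by exact_mod_cast hk
  have : (S + y) / ((k : ℝ) + 1) - S / k = (y - S / k) / ((k : ℝ) + 1) := by
    field_simp
    ring
  rw [this, abs_div, abs_of_pos (by positivity : (0 : ℝ) < k + 1)]
  gcongr
  have h1 : 0 ≤ S / k := by positivity
  have h2 : S / k ≤ 1 := (div_le_one hk').mpr hSk
  rw [abs_le]
  constructor <;> linarith

/-- The bias estimate differs little from the mean label of the points strictly inside the bin. -/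
theorem abs_biasEstimate_sub_le {B b : ℕ} (hb : b ∈ Finset.Icc 1 B) (hn : 2 * B ≤ n)
    (s y : Fin n → unitInterval) :
    |biasEstimate B s y b -
        (∑ r ∈ Finset.Ioo (boundary n B (b - 1)) (boundary n B b), (orderedLabel s y r : ℝ)) /
          ((boundary n B b - boundary n B (b - 1) - 1 : ℕ) : ℝ)| ≤ 1 / ((n / B : ℕ) : ℝ) := by
  rw [Finset.mem_Icc] at hb
  have hstep := boundary_add_div_le n B (b - 1)
  rw [Nat.sub_add_cancel hb.1] at hstep
  have hdiv : 2 ≤ n / B := (Nat.le_div_iff_mul_le (by omega)).mpr hn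
  set l := boundary n B (b - 1)
  set u := boundary n B b with hu
  unfold biasEstimate binRanks
  rw [← hu]
  -- Only the bins before the last include their right endpoint; in the last bin that endpoint is
  -- the conventional `S_(n+1)` and the two means coincide.
  by_cases hbB : b < B
  · rw [if_pos hbB]
    have hins : Finset.Ioc l u = insert u (Finset.Ioo l u) := by
      ext r
      simp only [Finset.mem_Ioc, Finset.mem_insert, Finset.mem_Ioo]
      omega
    have hcard : ((Finset.Ioc l u).card : ℝ) = ((u - l - 1 : ℕ) : ℝ) + 1 := by
      rw [Nat.card_Ioc]
      exact_mod_cast (by omega : u - l = (u - l - 1) + 1)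
    rw [hcard, hins, Finset.sum_insert (by simp), add_comm (orderedLabel s y u : ℝ)]
    refine (abs_mean_insert_sub_mean_le (by omega)
      (Finset.sum_nonneg fun r _ => (orderedLabel s y r).2.1) ?_
      (orderedLabel s y u).2.1 (orderedLabel s y u).2.2).trans ?_
    · calc _ ≤ ∑ _r ∈ Finset.Ioo l u, (1 : ℝ) :=
            Finset.sum_le_sum fun r _ => (orderedLabel s y r).2.2
        _ = _ := by simp
    · refine one_div_le_one_div_of_le (by positivity) ?_
      exact_mod_cast (by omega : n / B ≤ (u - l - 1) + 1)
  · rw [if_neg hbB]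
    have hIoo : Finset.Ioc l (u - 1) = Finset.Ioo l u := by
      ext r
      simp only [Finset.mem_Ioc, Finset.mem_Ioo]
      omega
    rw [hIoo, Nat.card_Ioo, sub_self, abs_zero]
    positivity

end Bins

/-! ### Assembling the bins -/

section Main

variable {𝒳 : Type*} [MeasurableSpace 𝒳]

/-- The pairs whose score is at least `a` and less than `b`. -/
def halfOpenBin (g : Predictor 𝒳) (a b : unitInterval) : Set (𝒳 × unitInterval) :=
  {z | a ≤ g.1 z.1 ∧ g.1 z.1 < b}

theorem measurableSet_halfOpenBin (g : Predictor 𝒳) (a b : unitInterval) :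
    MeasurableSet (halfOpenBin g a b) :=
  measurable_score g (measurableSet_Ici.inter measurableSet_Iio : MeasurableSet (Set.Ici a ∩ _))

theorem halfOpenBin_ae_eq_openBin (g : Predictor 𝒳) (P : Measure (𝒳 × unitInterval))
    (hg : P.map (fun z => (g.1 z.1 : ℝ)) ≪ (volume : Measure ℝ)) (a b : unitInterval) :
    halfOpenBin g a b =ᵐ[P] openBin g a b := by
  have : ∀ᵐ z ∂P, g.1 z.1 ≠ a := by
    rw [ae_iff]
    simpa using measure_score_eq g P hg a
  filter_upwards [this] with z hz
  refine propext (and_congr_left fun _ => ?_)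
  exact ⟨fun h => lt_of_le_of_ne h hz.symm, le_of_lt⟩

/-- If every bin is calibrated up to `ε`, so is the recalibrated predictor. -/
theorem approxCalibrated_of_bins {n B : ℕ} (hB : 1 ≤ B) (g : Predictor 𝒳)
    (P : Measure (𝒳 × unitInterval)) [IsProbabilityMeasure P]
    (hg : P.map (fun z => (g.1 z.1 : ℝ)) ≪ (volume : Measure ℝ)) {ε : ℝ} (hε : 0 ≤ ε)
    (D : Dataset 𝒳 n)
    (hbin : ∀ b ∈ Finset.Icc 1 B,
      |∫ z in halfOpenBin g (orderStat (scores g D) (boundary n B (b - 1)))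
            (orderStat (scores g D) (boundary n B b)),
          ((z.2 : ℝ) - biasEstimate B (scores g D) (fun i => (D i).2) b) ∂P| ≤
        ε * P.real (halfOpenBin g (orderStat (scores g D) (boundary n B (b - 1)))
            (orderStat (scores g D) (boundary n B b)))) :
    ApproxCalibrated P (originalUMD n B g D) ε := by
  set bin : ℕ → Set (𝒳 × unitInterval) := fun b =>
    halfOpenBin g (orderStat (scores g D) (boundary n B (b - 1)))
      (orderStat (scores g D) (boundary n B b)) with hbindef
  set est : ℕ → ℝ := fun b => biasEstimate B (scores g D) (fun i => (D i).2) b with hest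
  have hval : ∀ x, (((originalUMD n B g D).1 x : unitInterval) : ℝ) =
      binnedScore B (scores g D) (fun i => (D i).2) (g.1 x) := fun _ => rfl
  have hbinval : ∀ b ∈ Finset.Icc 1 B, ∀ z ∈ bin b,
      (((originalUMD n B g D).1 z.1 : unitInterval) : ℝ) = est b := fun b hb z hz => by
    rw [hval, binnedScore_eq hb _ _ hz.1 hz.2]
  have hdisj : ∀ b ∈ Finset.Icc 1 B, ∀ c ∈ Finset.Icc 1 B, b < c → Disjoint (bin b) (bin c) := by
    intro b hb c hc hlt
    refine Set.disjoint_left.mpr fun z hz hz' => ?_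
    have hm := (orderStat_mono (scores g D)).comp (boundary_mono n B) (show b ≤ c - 1 by omega)
    exact (hz.2.trans_le (hm.trans hz'.1)).false
  refine approxCalibrated_of_levelSets P _ hε ?_ fun r => ?_
  · refine Set.Finite.of_finite_image (f := ((↑) : unitInterval → ℝ)) ?_
      Subtype.val_injective.injOn
    -- The value 0 accounts for points with `g x = 1`, which belong to no bin.
    refine ((Finset.Icc 1 B).image est ∪ {0} : Finset ℝ).finite_toSet.subset ?_
    rintro _ ⟨_, ⟨x, rfl⟩, rfl⟩
    rw [hval]
    by_cases ht : g.1 x < 1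
    · obtain ⟨b, hb, h1, h2⟩ := exists_bin hB (scores g D) ht
      rw [binnedScore_eq hb _ _ h1 h2]
      simp only [Finset.coe_union, Finset.coe_image]
      exact Or.inl ⟨b, hb, rfl⟩
    · have : binnedScore B (scores g D) (fun i => (D i).2) (g.1 x) = 0 :=
        Finset.sum_eq_zero fun b _ => if_neg fun h =>
          ht (h.2.trans_le unitInterval.le_one')
      rw [this]
      simp
  · classical
    -- Different bins may have equal estimates. Up to the null set where `g = 1`, the level set is
    -- the disjoint union of the bins in `J`, and their mass-weighted bounds add.
    set J := (Finset.Icc 1 B).filter fun b => est b = r with hJ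
    have hlevel : {z : 𝒳 × unitInterval | (originalUMD n B g D).1 z.1 = r} =ᵐ[P]
        (⋃ b ∈ J, bin b : Set (𝒳 × unitInterval)) := by
      have hne : ∀ᵐ z ∂P, g.1 z.1 ≠ 1 := by
        rw [ae_iff]
        simpa using measure_score_eq g P hg 1
      filter_upwards [hne] with z hz
      have ht : g.1 z.1 < 1 := lt_of_le_of_ne unitInterval.le_one' hz
      refine propext ⟨fun hr => ?_, fun hr => ?_⟩
      · obtain ⟨b, hb, h1, h2⟩ := exists_bin hB (scores g D) ht
        have hr : (originalUMD n B g D).1 z.1 = r := hr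
        refine Set.mem_iUnion₂.mpr ⟨b, Finset.mem_filter.mpr ⟨hb, ?_⟩, h1, h2⟩
        rw [← hbinval b hb z ⟨h1, h2⟩, hr]
      · obtain ⟨b, hb, hz'⟩ := Set.mem_iUnion₂.mp hr
        obtain ⟨hb, hbr⟩ := Finset.mem_filter.mp hb
        exact Subtype.ext ((hbinval b hb z hz').trans hbr)
    have hpw : Set.PairwiseDisjoint (↑J) bin := by
      intro b hb c hc hbc
      have hb' := (Finset.mem_filter.mp hb).1
      have hc' := (Finset.mem_filter.mp hc).1
      rcases lt_or_gt_of_ne hbc with hlt | hlt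
      · exact hdisj b hb' c hc' hlt
      · exact (hdisj c hc' b hb' hlt).symm
    have hbinm : ∀ b ∈ J, MeasurableSet (bin b) := fun b _ => measurableSet_halfOpenBin g _ _
    have hint : Integrable (fun z : 𝒳 × unitInterval => (z.2 : ℝ) - r) P :=
      (integrable_label P).sub (integrable_const _)
    rw [setIntegral_congr_set hlevel, measureReal_congr hlevel,
      integral_biUnion_finset J hbinm hpw fun b _ => hint.integrableOn,
      measureReal_biUnion_finset hpw hbinm, Finset.mul_sum]
    refine (Finset.abs_sum_le_sum_abs _ _).trans (Finset.sum_le_sum fun b hb => ?_)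
    obtain ⟨hb, hbr⟩ := Finset.mem_filter.mp hb
    have := hbin b hb
    rw [← hbr]
    exact this

/-- The width `t` is chosen so that equality holds at `k = K`; more points only help. -/
theorem two_mul_exp_le {B K k : ℕ} {α t : ℝ} (hB : 1 ≤ B) (hα0 : 0 < α) (hα1 : α < 1)
    (hK : 1 ≤ K) (hKk : K ≤ k)
    (ht : t = Real.sqrt (Real.log (2 * (B : ℝ) / α) / (2 * (K : ℝ)))) :
    2 * Real.exp (-2 * (k : ℝ) * t ^ 2) ≤ α / B := by
  have hB' : (1 : ℝ) ≤ B := by exact_mod_cast hB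
  have hK' : (1 : ℝ) ≤ K := by exact_mod_cast hK
  have hKk' : (K : ℝ) ≤ k := by exact_mod_cast hKk
  have hlog : 0 ≤ Real.log (2 * (B : ℝ) / α) :=
    Real.log_nonneg ((one_le_div hα0).mpr (by linarith))
  have hsq : t ^ 2 = Real.log (2 * (B : ℝ) / α) / (2 * (K : ℝ)) := by
    rw [ht, Real.sq_sqrt (by positivity)]
  have hle : -2 * (k : ℝ) * t ^ 2 ≤ -Real.log (2 * (B : ℝ) / α) := by
    have : -2 * (K : ℝ) * t ^ 2 = -Real.log (2 * (B : ℝ) / α) := by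
      rw [hsq]
      field_simp
    rw [← this]
    nlinarith [sq_nonneg t]
  calc 2 * Real.exp (-2 * (k : ℝ) * t ^ 2)
      ≤ 2 * Real.exp (-Real.log (2 * (B : ℝ) / α)) := by gcongr
    _ = α / B := by
        rw [Real.exp_neg, Real.exp_log (by positivity)]
        field_simp

end Main

end HistogramBinning

open HistogramBinning in
theorem corollary1 {𝒳 : Type*} [MeasurableSpace 𝒳] (n B : ℕ) (hB : 1 ≤ B) (hn : 2 * B ≤ n)
    (α : ℝ) (hα0 : 0 < α) (hα1 : α < 1) (ε : ℝ)
    (hε : ε = Real.sqrt (Real.log (2 * (B : ℝ) / α) / (2 * (((n / B : ℕ) : ℝ) - 1)))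
      + 1 / ((n / B : ℕ) : ℝ))
    (g : Predictor 𝒳) (P : Measure (𝒳 × unitInterval)) [IsProbabilityMeasure P]
    (hg : P.map (fun z => (g.1 z.1 : ℝ)) ≪ (volume : Measure ℝ)) :
    ConditionallyCalibratedAt (originalUMD n B) ε α g P ∧
      HoldsWithProb P n α (fun D => ∀ p : ℝ, 1 ≤ p → ece P (originalUMD n B g D) p ≤ ε) := by
  have hdiv : 2 ≤ n / B := (Nat.le_div_iff_mul_le (by omega)).mpr hn
  set t := Real.sqrt (Real.log (2 * (B : ℝ) / α) / (2 * (((n / B : ℕ) : ℝ) - 1))) with ht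
  have ht0 : 0 ≤ t := Real.sqrt_nonneg _
  have hε0 : 0 ≤ ε := by
    rw [hε]
    positivity
  have hcal : ConditionallyCalibratedAt (originalUMD n B) ε α g P := by
    set bad : ℕ → Set (Dataset 𝒳 n) := fun b =>
      {D | t * P.real (openBin g (orderStat (scores g D) (boundary n B (b - 1)))
            (orderStat (scores g D) (boundary n B b))) <
          |(∑ r ∈ Finset.Ioo (boundary n B (b - 1)) (boundary n B b),
              (orderedLabel (scores g D) (fun i => (D i).2) r : ℝ)) /
              ((boundary n B b - boundary n B (b - 1) - 1 : ℕ) : ℝ) *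
              P.real (openBin g (orderStat (scores g D) (boundary n B (b - 1)))
                (orderStat (scores g D) (boundary n B b))) -
            ∫ z in openBin g (orderStat (scores g D) (boundary n B (b - 1)))
                (orderStat (scores g D) (boundary n B b)), (z.2 : ℝ) ∂P|} with hbad
    have hsub : {D | ¬ ApproxCalibrated P (originalUMD n B g D) ε} ⊆
        ⋃ b ∈ Finset.Icc 1 B, bad b := by
      intro D hD
      by_contra hgood
      refine hD (approxCalibrated_of_bins hB g P hg hε0 D fun b hb => ?_)
      have hDb : D ∉ bad b := fun h => hgood (Set.mem_iUnion₂.mpr ⟨b, hb, h⟩)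
      have hest := abs_biasEstimate_sub_le hb hn (scores g D) (fun i => (D i).2)
      have hae := halfOpenBin_ae_eq_openBin g P hg
        (orderStat (scores g D) (boundary n B (b - 1))) (orderStat (scores g D) (boundary n B b))
      simp only [hbad, Set.mem_ofPred_eq, not_lt] at hDb
      rw [setIntegral_congr_set hae, measureReal_congr hae,
        integral_sub (integrable_label P).integrableOn (integrable_const _), setIntegral_const,
        smul_eq_mul, hε]
      set q := P.real (openBin g (orderStat (scores g D) (boundary n B (b - 1)))
        (orderStat (scores g D) (boundary n B b)))
      set v := ∫ z in openBin g (orderStat (scores g D) (boundary n B (b - 1)))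
        (orderStat (scores g D) (boundary n B b)), (z.2 : ℝ) ∂P
      set M := (∑ r ∈ Finset.Ioo (boundary n B (b - 1)) (boundary n B b),
        (orderedLabel (scores g D) (fun i => (D i).2) r : ℝ)) /
          ((boundary n B b - boundary n B (b - 1) - 1 : ℕ) : ℝ)
      set π := biasEstimate B (scores g D) (fun i => (D i).2) b
      have hq : 0 ≤ q := measureReal_nonneg
      -- The first term is the sampling error of the interior mean `M`; the second is the endpoint
      -- bias of the actual estimate `π`. They give the two summands of `ε`.
      calc |v - q * π| = |(-(M * q - v)) + (-((π - M) * q))| := by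
            congr 1
            ring
        _ ≤ |M * q - v| + |π - M| * q := by
            refine (abs_add_le _ _).trans_eq ?_
            rw [abs_neg, abs_neg, abs_mul, abs_of_nonneg hq]
        _ ≤ t * q + 1 / ((n / B : ℕ) : ℝ) * q :=
            add_le_add hDb (mul_le_mul_of_nonneg_right hest hq)
        _ = _ := by ring
    have hone : ∀ b ∈ Finset.Icc 1 B,
        Measure.pi (fun _ : Fin n => P) (bad b) ≤ ENNReal.ofReal (α / B) := by
      intro b hb
      rw [Finset.mem_Icc] at hb
      have hstep := boundary_add_div_le n B (b - 1)
      rw [Nat.sub_add_cancel hb.1] at hstep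
      have hlast : boundary n B b ≤ n + 1 :=
        (boundary_mono n B hb.2).trans_eq (boundary_last n hB)
      refine (measure_deviation_le g P hg (by omega) hlast ht0).trans
        (ENNReal.ofReal_le_ofReal ?_)
      -- Consecutive boundaries differ by at least `⌊n/B⌋`, so the interior has at least `⌊n/B⌋ - 1`
      -- points; `2 * B ≤ n` makes this positive.
      refine two_mul_exp_le (K := n / B - 1) hB hα0 hα1 (by omega) (by omega) ?_
      rw [ht, Nat.cast_sub (by omega), Nat.cast_one]
    calc _ ≤ Measure.pi (fun _ : Fin n => P) (⋃ b ∈ Finset.Icc 1 B, bad b) := measure_mono hsub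
      _ ≤ ∑ b ∈ Finset.Icc 1 B, Measure.pi (fun _ : Fin n => P) (bad b) :=
          measure_biUnion_finset_le _ _
      _ ≤ ∑ _b ∈ Finset.Icc 1 B, ENNReal.ofReal (α / B) := Finset.sum_le_sum hone
      _ = ENNReal.ofReal α := by
          have hB' : (B : ℝ) ≠ 0 := by positivity
          rw [Finset.sum_const, Nat.card_Icc, Nat.add_sub_cancel, nsmul_eq_mul,
            ← ENNReal.ofReal_natCast, ← ENNReal.ofReal_mul (Nat.cast_nonneg _),
            mul_div_cancel₀ _ hB']
  refine ⟨hcal, le_trans (measure_mono ?_) (show Measure.pi (fun _ : Fin n => P)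
    {D | ¬ ApproxCalibrated P (originalUMD n B g D) ε} ≤ ENNReal.ofReal α from hcal)⟩
  exact fun D hD hD' => hD fun p hp => ApproxCalibrated.ece_le hD' hε0 hp
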